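/- Let $G$ be a connected finite simple undirected graph with $N \ge 2$ vertices. For a finite simple graph $H$ on $N$ vertices let $L(H) = D - A$ be its combinatorial Laplacian ($D$ the diagonal matrix of degrees, $A$ the adjacency matrix), with real eigenvalues $\lambda_1(H) \le \lambda_2(H) \le \dots \le \lambda_N(H)$ listed with multiplicity; the algebraic connectivity of $H$ is $\lambda_2(H)$. Let $P_N$ be the path graph on $N$ vertices. Then $$\lambda_2(G) \ \ge\ \lambda_2(P_N) \ =\ 2\left(1 - \cos\frac{\pi}{N}\right) \ =\ 4 \sin^2\left(\frac{\pi}{2N}\right).$$ -/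

import Mathlib

namespace SimpleGraph

open Classical in
/-- The eigenvalues of the (combinatorial) Laplacian matrix `D - A` of a finite simple graph,
listed with multiplicity in ascending order. Indices start at `0`, so the eigenvalue usually
written `λ_i` is the one with index `i - 1`. -/
noncomputable def lapEigenvalue {V : Type*} [Fintype V] (G : SimpleGraph V)
    (i : Fin (Fintype.card V)) : ℝ :=
  (G.isHermitian_lapMatrix ℝ).eigenvalues₀ i.rev

/-- The algebraic connectivity of a finite simple graph on at least two vertices: the second
smallest eigenvalue `λ_2` of its Laplacian, counted with multiplicity. -/
noncomputable def algebraicConnectivity {V : Type*} [Fintype V] (G : SimpleGraph V)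
    (h : 2 ≤ Fintype.card V) : ℝ :=
  G.lapEigenvalue ⟨1, h⟩

end SimpleGraph

/-!
Call the sum of `(x i - x j) ^ 2` over the edges of a graph the Dirichlet energy of `x`; it is the
quadratic form of the Laplacian. For a connected graph the bottom eigenvector is constant, so the
algebraic connectivity is the least energy of a unit vector with coordinate sum zero.

*Comparison with the path.* Let `x` be a unit eigenvector of `G` for `λ₂`, and number the vertices
so that `x` is nondecreasing, with values `y 0 ≤ y 1 ≤ ⋯`. An edge joining positions `i < j`
contributes `(y j - y i) ^ 2`, which is at least the sum of `(y (k + 1) - y k) ^ 2` over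
`i ≤ k < j`, as increments of the same sign have superadditive squares. Since `G` is connected, every
`k` lies below at least one edge in this sense, so the energy of `x` on `G` is at least the energy
of `y` on the path (`Connected.dirichletEnergy_pathGraph_le`). As `y` has coordinate sum zero, the
latter is at least the algebraic connectivity of the path.

*The path.* For `j < N` the vector with entries `cos ((k + 1/2) π j / N)` is an eigenvector of the
path with eigenvalue `2 (1 - cos (π j / N))`. These `N` numbers strictly increase with `j`, so they
are the whole ordered spectrum (`lapEigenvalue_pathGraph`).
-/

namespace SimpleGraph

/-! ### Dirichlet energy -/

open Finset Matrix

variable {V : Type*} [Fintype V]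

open Classical in
/-- The Dirichlet energy of a function on the vertices of a graph: the sum of `(x i - x j) ^ 2` over
the edges. The double sum runs over ordered pairs and meets each edge twice. -/
noncomputable def dirichletEnergy (G : SimpleGraph V) (x : V → ℝ) : ℝ :=
  (∑ i, ∑ j, if G.Adj i j then (x i - x j) ^ 2 else 0) / 2

open Classical in
theorem dotProduct_lapMatrix_mulVec (G : SimpleGraph V) (x : V → ℝ) :
    x ⬝ᵥ (G.lapMatrix ℝ *ᵥ x) = G.dirichletEnergy x := by
  rw [← toLinearMap₂'_apply', lapMatrix_toLinearMap₂', dirichletEnergy]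

theorem dirichletEnergy_nonneg (G : SimpleGraph V) (x : V → ℝ) : 0 ≤ G.dirichletEnergy x := by
  unfold dirichletEnergy
  positivity

open Classical in
theorem dirichletEnergy_eq_sum_lt [LinearOrder V] (G : SimpleGraph V) (x : V → ℝ) :
    G.dirichletEnergy x = ∑ i, ∑ j, if G.Adj i j ∧ i < j then (x i - x j) ^ 2 else 0 := by
  have key : (∑ i, ∑ j, if G.Adj i j then (x i - x j) ^ 2 else 0) =
      (∑ i, ∑ j, if G.Adj i j ∧ i < j then (x i - x j) ^ 2 else 0) +
        ∑ i, ∑ j, if G.Adj j i ∧ j < i then (x j - x i) ^ 2 else 0 := by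
    simp_rw [← sum_add_distrib]
    refine sum_congr rfl fun i _ ↦ sum_congr rfl fun j _ ↦ ?_
    rcases lt_trichotomy i j with h | rfl | h
    · simp [h, h.not_gt]
    · simp
    · simp [h, h.not_gt, G.adj_comm i j, sub_sq_comm (x i)]
  rw [dirichletEnergy, key, sum_comm (γ := V) (f := fun i j ↦ if G.Adj j i ∧ j < i then _ else _)]
  ring

theorem dirichletEnergy_comap_equiv {W : Type*} [Fintype W] (G : SimpleGraph V) (σ : W ≃ V)
    (x : V → ℝ) : (G.comap σ).dirichletEnergy (x ∘ σ) = G.dirichletEnergy x := by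
  simp only [dirichletEnergy, comap_adj, Function.comp_apply]
  rw [← σ.sum_comp (fun i ↦ ∑ j, _)]
  congr 1
  refine sum_congr rfl fun i _ ↦ ?_
  rw [← σ.sum_comp (fun j ↦ _)]
  rfl

/-! ### Comparison of energies with the path -/

theorem sum_Ico_sq_sub_le_sq_sub {z : ℕ → ℝ} (hz : Monotone z) {i j : ℕ} (hij : i ≤ j) :
    ∑ k ∈ Ico i j, (z (k + 1) - z k) ^ 2 ≤ (z j - z i) ^ 2 := by
  induction j, hij using Nat.le_induction with
  | base => simp
  | succ j hij ih =>
    rw [sum_Ico_succ_top hij]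
    -- The square of a sum of two nonnegative increments dominates the sum of their squares.
    nlinarith [mul_nonneg (sub_nonneg.2 (hz hij)) (sub_nonneg.2 (hz j.le_succ))]

theorem dirichletEnergy_pathGraph (n : ℕ) (z : ℕ → ℝ) :
    (pathGraph (n + 1)).dirichletEnergy (fun i ↦ z i) =
      ∑ k ∈ range n, (z (k + 1) - z k) ^ 2 := by
  classical
  rw [dirichletEnergy_eq_sum_lt, Fin.sum_univ_castSucc, ← Fin.sum_univ_eq_sum_range
    (fun k ↦ (z (k + 1) - z k) ^ 2)]
  have h0 : (∑ j, if (pathGraph (n + 1)).Adj (Fin.last n) j ∧ Fin.last n < j then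
      (z (Fin.last n) - z j) ^ 2 else 0) = 0 :=
    sum_eq_zero fun j _ ↦ if_neg fun h ↦ (Fin.le_last j).not_gt h.2
  rw [h0, add_zero]
  refine sum_congr rfl fun i _ ↦ ?_
  rw [sum_eq_single i.succ]
  · simp [pathGraph_adj, sub_sq_comm (z i)]
  · intro j _ hj
    refine if_neg fun ⟨h, hlt⟩ ↦ hj (Fin.ext ?_)
    rw [pathGraph_adj] at h
    simp [Fin.lt_def] at h hlt ⊢
    lia
  · simp

/-- In a connected graph on `0, …, n` some edge crosses the cut between `k` and `k + 1`. -/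
theorem Connected.exists_adj_le_lt {n : ℕ} {H : SimpleGraph (Fin (n + 1))} (hH : H.Connected)
    {k : ℕ} (hk : k < n) : ∃ i j : Fin (n + 1), H.Adj i j ∧ (i : ℕ) ≤ k ∧ k < j := by
  obtain ⟨p⟩ := hH.preconnected 0 (Fin.last n)
  obtain ⟨d, -, h1, h2⟩ := p.exists_boundary_dart {i | (i : ℕ) ≤ k} (by simp) (by simpa using hk)
  exact ⟨d.fst, d.snd, d.adj, h1, not_le.1 h2⟩

/-- Among connected graphs on `Fin N`, the path minimizes the energy of a monotone function. -/
theorem Connected.dirichletEnergy_pathGraph_le {N : ℕ} {H : SimpleGraph (Fin N)}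
    (hH : H.Connected) {y : Fin N → ℝ} (hy : Monotone y) :
    (pathGraph N).dirichletEnergy y ≤ H.dirichletEnergy y := by
  classical
  obtain _ | n := N
  · simp [dirichletEnergy]
  -- Extending `y` to all of `ℕ` by its last value keeps it monotone.
  obtain ⟨z, hz, rfl⟩ : ∃ z : ℕ → ℝ, Monotone z ∧ y = fun i : Fin (n + 1) ↦ z i := by
    refine ⟨fun k ↦ y ⟨min k n, by lia⟩, fun a b hab ↦ hy ?_, ?_⟩
    · exact Fin.mk_le_mk.2 (min_le_min_right n hab)
    · funext i
      exact congrArg y (Fin.ext (min_eq_left (Nat.lt_succ_iff.1 i.2)).symm)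
  rw [dirichletEnergy_pathGraph, dirichletEnergy_eq_sum_lt]
  calc ∑ k ∈ range n, (z (k + 1) - z k) ^ 2
      ≤ ∑ k ∈ range n, ∑ p : Fin (n + 1) × Fin (n + 1),
          if H.Adj p.1 p.2 ∧ (p.1 : ℕ) ≤ k ∧ k < p.2 then (z (k + 1) - z k) ^ 2 else 0 := by
        refine sum_le_sum fun k hk ↦ ?_
        obtain ⟨i, j, h⟩ := hH.exists_adj_le_lt (mem_range.1 hk)
        refine le_trans (by rw [if_pos h]) (single_le_sum (fun p _ ↦ ?_) (mem_univ (i, j)))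
        positivity
    _ ≤ _ := by
        rw [sum_comm, ← Fintype.sum_prod_type']
        refine sum_le_sum fun p _ ↦ ?_
        obtain ⟨i, j⟩ := p
        by_cases h : H.Adj i j ∧ i < j
        · rw [if_pos h, sub_sq_comm, ← sum_filter]
          refine le_trans (sum_le_sum_of_subset_of_nonneg (fun k hk ↦ ?_) fun _ _ _ ↦ sq_nonneg _)
            (sum_Ico_sq_sub_le_sq_sub hz (Fin.lt_def.1 h.2).le)
          simp only [mem_filter] at hk
          exact mem_Ico.2 hk.2.2
        · rw [if_neg h]
          refine (sum_eq_zero fun k _ ↦ if_neg fun h' ↦ h ⟨h'.1, ?_⟩).le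
          exact Fin.lt_def.2 (h'.2.1.trans_lt h'.2.2)

/-! ### Spectrum of the Laplacian -/

open Classical in
/-- An orthonormal eigenbasis of the Laplacian, ordered as the eigenvalues are. -/
theorem exists_orthonormalBasis_lapMatrix_mulVec (G : SimpleGraph V) :
    ∃ b : OrthonormalBasis (Fin (Fintype.card V)) ℝ (EuclideanSpace ℝ V),
      ∀ i, G.lapMatrix ℝ *ᵥ (b i).ofLp = G.lapEigenvalue i • (b i).ofLp := by
  let hA := G.isHermitian_lapMatrix ℝ
  let e : Fin (Fintype.card V) ≃ V := Fintype.equivOfCardEq (Fintype.card_fin _)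
  refine ⟨hA.eigenvectorBasis.reindex (Fin.revPerm.trans e).symm, fun i ↦ ?_⟩
  have h := hA.mulVec_eigenvectorBasis (e i.rev)
  have h' : hA.eigenvalues (e i.rev) = G.lapEigenvalue i := by
    rw [IsHermitian.eigenvalues]
    exact congrArg hA.eigenvalues₀ (e.symm_apply_apply i.rev)
  rw [h'] at h
  simpa using h

theorem lapEigenvalue_monotone (G : SimpleGraph V) : Monotone G.lapEigenvalue := by
  classical
  intro i j hij
  exact (G.isHermitian_lapMatrix ℝ).eigenvalues₀_antitone (Fin.rev_le_rev.2 hij)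

theorem dotProduct_lapMatrix_mulVec_comm (G : SimpleGraph V) [DecidableEq V] [DecidableRel G.Adj]
    (x y : V → ℝ) :
    x ⬝ᵥ (G.lapMatrix ℝ *ᵥ y) = (G.lapMatrix ℝ *ᵥ x) ⬝ᵥ y := by
  rw [dotProduct_mulVec, ← mulVec_transpose, G.isSymm_lapMatrix ℝ]

theorem inner_eq_dotProduct (x y : EuclideanSpace ℝ V) : inner ℝ x y = x.ofLp ⬝ᵥ y.ofLp := by
  simp [PiLp.inner_apply, dotProduct, mul_comm]

theorem mem_range_lapEigenvalue (G : SimpleGraph V) [DecidableEq V] [DecidableRel G.Adj] {μ : ℝ}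
    {x : V → ℝ} (hx : x ≠ 0) (h : G.lapMatrix ℝ *ᵥ x = μ • x) : μ ∈ Set.range G.lapEigenvalue := by
  obtain ⟨b, hb⟩ := G.exists_orthonormalBasis_lapMatrix_mulVec
  -- `x` is not orthogonal to some `b i`, and eigenvectors for distinct eigenvalues are orthogonal.
  obtain ⟨i, hi⟩ : ∃ i, inner ℝ (b i) (WithLp.toLp 2 x) ≠ 0 := by
    by_contra! h0
    apply hx
    have := b.sum_repr' (WithLp.toLp 2 x)
    simpa [h0] using this.symm
  refine ⟨i, mul_right_cancel₀ hi ?_⟩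
  have := G.dotProduct_lapMatrix_mulVec_comm (b i).ofLp x
  rw [h, show G.lapMatrix ℝ *ᵥ (b i).ofLp = G.lapEigenvalue i • (b i).ofLp by convert hb i,
    dotProduct_smul, smul_dotProduct] at this
  simpa [inner_eq_dotProduct] using this.symm

open Classical in
theorem dirichletEnergy_eq_sum_lapEigenvalue (G : SimpleGraph V)
    {b : OrthonormalBasis (Fin (Fintype.card V)) ℝ (EuclideanSpace ℝ V)}
    (hb : ∀ i, G.lapMatrix ℝ *ᵥ (b i).ofLp = G.lapEigenvalue i • (b i).ofLp) (x : V → ℝ) :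
    G.dirichletEnergy x = ∑ i, G.lapEigenvalue i * ((b i).ofLp ⬝ᵥ x) ^ 2 := by
  rw [← dotProduct_lapMatrix_mulVec]
  have h := b.sum_inner_mul_inner (WithLp.toLp 2 x) (WithLp.toLp 2 (G.lapMatrix ℝ *ᵥ x))
  simp only [inner_eq_dotProduct, dotProduct_lapMatrix_mulVec_comm, hb, smul_dotProduct] at h
  rw [dotProduct_lapMatrix_mulVec_comm, ← h]
  refine sum_congr rfl fun i _ ↦ ?_
  rw [dotProduct_comm x, smul_eq_mul]
  ring

theorem lapEigenvalue_nonneg (G : SimpleGraph V) (i : Fin (Fintype.card V)) :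
    0 ≤ G.lapEigenvalue i := by
  classical
  obtain ⟨b, hb⟩ := G.exists_orthonormalBasis_lapMatrix_mulVec
  have h := G.dotProduct_lapMatrix_mulVec (b i).ofLp
  have h1 : (b i).ofLp ⬝ᵥ (b i).ofLp = 1 := by simp [← inner_eq_dotProduct]
  rw [hb, dotProduct_smul, h1, smul_eq_mul, mul_one] at h
  exact h ▸ G.dirichletEnergy_nonneg _

theorem lapEigenvalue_zero (G : SimpleGraph V) (h : 0 < Fintype.card V) :
    G.lapEigenvalue ⟨0, h⟩ = 0 := by
  classical
  have := Fintype.card_pos_iff.1 h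
  obtain ⟨i, hi⟩ := G.mem_range_lapEigenvalue (μ := 0) (x := fun _ ↦ 1)
    (fun h ↦ one_ne_zero (congrFun h this.some)) (by simp [lapMatrix_mulVec_const_eq_zero])
  exact ((G.lapEigenvalue_monotone (Fin.mk_le_of_le_val i.val.zero_le)).trans_eq hi).antisymm
    (G.lapEigenvalue_nonneg _)

open Classical in
theorem Connected.exists_eq_const {G : SimpleGraph V} (hG : G.Connected) {x : V → ℝ}
    (hx : G.lapMatrix ℝ *ᵥ x = 0) : ∃ c, x = fun _ ↦ c :=
  ⟨x hG.nonempty.some, funext fun _ ↦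
    G.lapMatrix_mulVec_eq_zero_iff_forall_reachable.1 hx _ _ (hG.preconnected _ _)⟩

/-- The algebraic connectivity of a connected graph is the energy of some unit vector with
coordinate sum zero. -/
theorem Connected.exists_dirichletEnergy_eq {G : SimpleGraph V} (hG : G.Connected)
    (h : 2 ≤ Fintype.card V) : ∃ x : V → ℝ, ∑ v, x v = 0 ∧ ∑ v, x v ^ 2 = 1 ∧
      G.dirichletEnergy x = G.algebraicConnectivity h := by
  classical
  obtain ⟨b, hb⟩ := G.exists_orthonormalBasis_lapMatrix_mulVec
  have h0 : 0 < Fintype.card V := by lia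
  obtain ⟨c, hc⟩ := hG.exists_eq_const (x := b ⟨0, h0⟩) (by rw [hb, lapEigenvalue_zero, zero_smul])
  have h1 : (b ⟨1, h⟩).ofLp ⬝ᵥ (b ⟨1, h⟩).ofLp = 1 := by simp [← inner_eq_dotProduct]
  have h01 : (b ⟨0, h0⟩).ofLp ⬝ᵥ (b ⟨1, h⟩).ofLp = 0 := by
    rw [← inner_eq_dotProduct, b.inner_eq_zero (by simp)]
  have h00 : (b ⟨0, h0⟩).ofLp ⬝ᵥ (b ⟨0, h0⟩).ofLp = 1 := by simp [← inner_eq_dotProduct]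
  refine ⟨b ⟨1, h⟩, ?_, ?_, ?_⟩
  · have hc0 : c ≠ 0 := by
      rintro rfl
      simp [hc, dotProduct] at h00
    simpa [hc, dotProduct, ← mul_sum, hc0] using h01
  · simpa [dotProduct, sq] using h1
  · rw [← dotProduct_lapMatrix_mulVec, hb, dotProduct_smul, h1, smul_eq_mul, mul_one]
    rfl

/-- The Poincaré inequality of a connected graph, with the algebraic connectivity as constant. -/
theorem Connected.algebraicConnectivity_mul_le {G : SimpleGraph V} (hG : G.Connected)
    (h : 2 ≤ Fintype.card V) {x : V → ℝ} (hx : ∑ v, x v = 0) :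
    G.algebraicConnectivity h * ∑ v, x v ^ 2 ≤ G.dirichletEnergy x := by
  classical
  obtain ⟨b, hb⟩ := G.exists_orthonormalBasis_lapMatrix_mulVec
  have h0 : 0 < Fintype.card V := by lia
  obtain ⟨c, hc⟩ := hG.exists_eq_const (x := b ⟨0, h0⟩) (by rw [hb, lapEigenvalue_zero, zero_smul])
  have hsum : ∑ v, x v ^ 2 = ∑ i, ((b i).ofLp ⬝ᵥ x) ^ 2 := by
    have := b.sum_inner_mul_inner (WithLp.toLp 2 x) (WithLp.toLp 2 x)
    simp only [inner_eq_dotProduct] at this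
    rw [show ∑ v, x v ^ 2 = x ⬝ᵥ x by simp [dotProduct, sq], ← this]
    refine sum_congr rfl fun i _ ↦ ?_
    rw [dotProduct_comm x, sq]
  rw [hsum, G.dirichletEnergy_eq_sum_lapEigenvalue hb, mul_sum]
  refine sum_le_sum fun i _ ↦ ?_
  -- The bottom eigenvector is constant, so `x` has no component along it.
  by_cases hi : i = ⟨0, h0⟩
  · have : (b i).ofLp ⬝ᵥ x = 0 := by
      rw [hi, hc]
      simp [dotProduct, ← mul_sum, hx]
    simp [this]
  · refine mul_le_mul_of_nonneg_right (G.lapEigenvalue_monotone ?_) (sq_nonneg _)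
    have : (i : ℕ) ≠ 0 := fun h' ↦ hi (Fin.ext h')
    exact Fin.mk_le_of_le_val (Nat.one_le_iff_ne_zero.2 this)

/-- Among connected graphs with a given number of vertices, the path minimizes the algebraic
connectivity. -/
theorem Connected.algebraicConnectivity_pathGraph_le {G : SimpleGraph V} (hG : G.Connected) {N : ℕ}
    (hV : Fintype.card V = N) (hP : 2 ≤ Fintype.card (Fin N)) (h : 2 ≤ Fintype.card V) :
    (pathGraph N).algebraicConnectivity hP ≤ G.algebraicConnectivity h := by
  obtain ⟨x, hx0, hx1, hx⟩ := hG.exists_dirichletEnergy_eq h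
  let e : Fin N ≃ V := (Fintype.equivFinOfCardEq hV).symm
  -- `σ` numbers the vertices in nondecreasing order of `x`.
  let σ : Fin N ≃ V := (Tuple.sort (x ∘ e)).trans e
  have hmono : Monotone (x ∘ σ) := Tuple.monotone_sort (x ∘ e)
  have hconn : (G.comap σ).Connected := (Iso.comap σ G).connected_iff.2 hG
  have hpath : (pathGraph N).Connected := by
    obtain _ | n := N
    · simp at hP
    · exact pathGraph_connected n
  have hle := hpath.algebraicConnectivity_mul_le hP (x := x ∘ σ) ((σ.sum_comp x).trans hx0)
  rw [show ∑ v, (x ∘ σ) v ^ 2 = 1 from (σ.sum_comp (x · ^ 2)).trans hx1, mul_one] at hle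
  calc _ ≤ _ := hle
    _ ≤ _ := hconn.dirichletEnergy_pathGraph_le hmono
    _ = _ := (G.dirichletEnergy_comap_equiv σ x).trans hx

/-! ### Spectrum of the path -/

/-- A strictly increasing `n`-tuple with all its values among those of a monotone `n`-tuple is equal
to it. -/
theorem _root_.StrictMono.eq_of_monotone_of_range_subset {α : Type*} [LinearOrder α] {n : ℕ}
    {f g : Fin n → α} (hf : StrictMono f) (hg : Monotone g) (h : Set.range f ⊆ Set.range g) :
    f = g := by
  choose σ hσ using fun i ↦ h (Set.mem_range_self i)
  have hmono : StrictMono σ := fun i j hij ↦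
    hg.reflect_lt (by rw [hσ, hσ]; exact hf hij)
  have : σ = id := hmono.range_inj strictMono_id |>.1 (by
    rw [(Finite.injective_iff_surjective.1 hmono.injective).range_eq, Set.range_id])
  funext i
  rw [← hσ, this, id]

theorem lapMatrix_mulVec_apply_eq_sum (G : SimpleGraph V) [DecidableEq V] [DecidableRel G.Adj]
    (x : V → ℝ) (v : V) :
    (G.lapMatrix ℝ *ᵥ x) v = ∑ u, if G.Adj v u then x v - x u else 0 := by
  rw [lapMatrix_mulVec_apply, ← sum_filter, sum_sub_distrib, sum_const, nsmul_eq_mul,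
    ← neighborFinset_eq_filter, card_neighborFinset_eq_degree]

/-- The Laplacian of the path is minus the second difference, on sequences extended beyond both ends
with reflecting boundary values. -/
theorem lapMatrix_pathGraph_mulVec_apply {N : ℕ} [DecidableRel (pathGraph N).Adj] {w : ℤ → ℝ}
    (h0 : w (-1) = w 0) (hN : w N = w (N - 1)) (k : Fin N) :
    ((pathGraph N).lapMatrix ℝ *ᵥ fun i ↦ w (i : ℕ)) k =
      2 * w (k : ℕ) - w ((k : ℕ) - 1) - w ((k : ℕ) + 1) := by
  have hsplit : ∀ u : Fin N, (if (pathGraph N).Adj k u then w (k : ℕ) - w (u : ℕ) else 0) =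
      (if (u : ℕ) = (k : ℕ) + 1 then w (k : ℕ) - w ((k : ℕ) + 1) else 0) +
        if (u : ℕ) + 1 = (k : ℕ) then w (k : ℕ) - w ((k : ℕ) - 1) else 0 := by
    intro u
    simp only [pathGraph_adj]
    by_cases h1 : (u : ℕ) = (k : ℕ) + 1
    · simp [h1, show ¬ ((k : ℕ) + 1 + 1 = k) by lia]
    · by_cases h2 : (u : ℕ) + 1 = (k : ℕ)
      · simp [← h2, show ¬ (u : ℕ) = u + 1 + 1 by lia]
      · simp [h1, h2, Ne.symm h1]
  have hup : (∑ u : Fin N, if (u : ℕ) = (k : ℕ) + 1 then w (k : ℕ) - w ((k : ℕ) + 1) else 0) =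
      w (k : ℕ) - w ((k : ℕ) + 1) := by
    by_cases hk : (k : ℕ) + 1 < N
    · rw [sum_eq_single ⟨k + 1, hk⟩ (fun u _ hu ↦ if_neg fun h ↦ hu (Fin.ext h)) (by simp)]
      simp
    · -- At the last vertex the missing difference is zero by reflection; similarly at the first.
      rw [sum_eq_zero fun u _ ↦ if_neg (by lia)]
      have : (N : ℤ) = (k : ℕ) + 1 := by lia
      rw [this] at hN
      simp [hN]
  have hdown : (∑ u : Fin N, if (u : ℕ) + 1 = (k : ℕ) then w (k : ℕ) - w ((k : ℕ) - 1) else 0) =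
      w (k : ℕ) - w ((k : ℕ) - 1) := by
    by_cases hk : (k : ℕ) = 0
    · rw [sum_eq_zero fun u _ ↦ if_neg (by lia)]
      simp [hk, h0]
    · rw [sum_eq_single ⟨k - 1, (Nat.sub_le _ _).trans_lt k.2⟩
        (fun u _ hu ↦ if_neg fun h ↦ hu (Fin.ext (by simp; lia))) (by simp)]
      rw [if_pos (by simp; lia)]
  rw [lapMatrix_mulVec_apply_eq_sum, sum_congr rfl fun u _ ↦ hsplit u, sum_add_distrib, hup, hdown]
  ring

theorem mem_range_lapEigenvalue_pathGraph {N j : ℕ} (hj : j < N) :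
    2 * (1 - Real.cos (Real.pi * j / N)) ∈ Set.range (pathGraph N).lapEigenvalue := by
  classical
  have hN : (0 : ℝ) < N := by exact_mod_cast (Nat.zero_le j).trans_lt hj
  set θ : ℝ := Real.pi * j / N with hθ
  have hθN : N * θ = j * Real.pi := by rw [hθ]; field_simp
  -- The shift by `1 / 2` makes the cosine symmetric about both reflection points.
  let w : ℤ → ℝ := fun k ↦ Real.cos ((k + 1 / 2) * θ)
  refine (pathGraph N).mem_range_lapEigenvalue (x := fun i ↦ w (i : ℕ)) ?_ ?_
  · -- The entry at the first vertex is `cos (θ / 2)`, which is positive.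
    refine fun h ↦ ne_of_gt ?_ (congrFun h ⟨0, (Nat.zero_le j).trans_lt hj⟩)
    have hjN : (j : ℝ) < N := by exact_mod_cast hj
    have hlt : θ < Real.pi := by
      rw [hθ, div_lt_iff₀ hN]
      exact mul_lt_mul_of_pos_left hjN Real.pi_pos
    have hnn : 0 ≤ θ := by positivity
    refine Real.cos_pos_of_mem_Ioo ⟨?_, ?_⟩ <;> simp <;> linarith
  · funext k
    rw [lapMatrix_pathGraph_mulVec_apply]
    · have := Real.cos_add_cos (((k : ℕ) + 1 + 1 / 2) * θ) (((k : ℕ) - 1 + 1 / 2) * θ)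
      rw [show (((k : ℕ) + 1 + 1 / 2) * θ + ((k : ℕ) - 1 + 1 / 2) * θ) / 2 =
        ((k : ℕ) + 1 / 2) * θ by ring, show (((k : ℕ) + 1 + 1 / 2) * θ -
        ((k : ℕ) - 1 + 1 / 2) * θ) / 2 = θ by ring] at this
      simp only [w, Pi.smul_apply, smul_eq_mul]
      push_cast
      linarith
    · simp only [w]
      rw [← Real.cos_neg]
      push_cast
      ring_nf
    · simp only [w]
      push_cast
      rw [show (N + 1 / 2) * θ = θ / 2 + j * Real.pi by rw [← hθN]; ring,
        show ((N : ℝ) - 1 + 1 / 2) * θ = j * Real.pi - θ / 2 by rw [← hθN]; ring,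
        Real.cos_add_nat_mul_pi, Real.cos_nat_mul_pi_sub]

theorem lapEigenvalue_pathGraph {N : ℕ} (j : Fin (Fintype.card (Fin N))) :
    (pathGraph N).lapEigenvalue j = 2 * (1 - Real.cos (Real.pi * (j : ℕ) / N)) := by
  have hlt (j : Fin (Fintype.card (Fin N))) : (j : ℕ) < N := j.2.trans_eq (Fintype.card_fin N)
  refine (congrFun (StrictMono.eq_of_monotone_of_range_subset (f := fun j ↦
    2 * (1 - Real.cos (Real.pi * (j : ℕ) / N))) ?_
    (pathGraph N).lapEigenvalue_monotone ?_) j).symm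
  · intro a b hab
    have hN : (0 : ℝ) < N := by exact_mod_cast (Nat.zero_le a).trans_lt (hlt a)
    have hbN : ((b : ℕ) : ℝ) ≤ N := by exact_mod_cast (hlt b).le
    have hab' : ((a : ℕ) : ℝ) < (b : ℕ) := by exact_mod_cast hab
    have hcos := Real.cos_lt_cos_of_nonneg_of_le_pi (x := Real.pi * (a : ℕ) / N)
      (y := Real.pi * (b : ℕ) / N) (by positivity)
      (by rw [div_le_iff₀ hN]; gcongr) (by gcongr)
    simp only
    linarith
  · rintro _ ⟨j, rfl⟩
    exact mem_range_lapEigenvalue_pathGraph (hlt j)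

theorem algebraicConnectivity_pathGraph {N : ℕ} (h : 2 ≤ Fintype.card (Fin N)) :
    (pathGraph N).algebraicConnectivity h = 2 * (1 - Real.cos (Real.pi / N)) := by
  rw [algebraicConnectivity, lapEigenvalue_pathGraph]
  simp

end SimpleGraph

theorem mainTheorem9 {V : Type*} [Fintype V] (G : SimpleGraph V) (hG : G.Connected)
    (N : ℕ) (hN : 2 ≤ N) (hV : Fintype.card V = N) :
    (SimpleGraph.pathGraph N).algebraicConnectivity (hN.trans_eq (Fintype.card_fin N).symm) ≤
        G.algebraicConnectivity (hN.trans_eq hV.symm) ∧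
      (SimpleGraph.pathGraph N).algebraicConnectivity (hN.trans_eq (Fintype.card_fin N).symm) =
        2 * (1 - Real.cos (Real.pi / N)) ∧
      2 * (1 - Real.cos (Real.pi / N)) = 4 * Real.sin (Real.pi / (2 * N)) ^ 2 := by
  refine ⟨hG.algebraicConnectivity_pathGraph_le hV _ _,
    SimpleGraph.algebraicConnectivity_pathGraph _, ?_⟩
  rw [Real.sin_sq_eq_half_sub, show 2 * (Real.pi / (2 * N)) = Real.pi / N by ring]
  ring
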